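/- Let $H, L$ be complex Hilbert spaces. A nest on a Hilbert space is a totally ordered set of orthogonal projections which contains $0$ and the identity $I$ and is closed under arbitrary intersections ($\bigwedge$) and closed linear spans ($\bigvee$) of ranges. Let $\mathcal M$ be a nest on $H$, let $\mathcal N$ be a nest on $L$, and let $\phi:\mathcal M\to\mathcal N$ be a nest homomorphism, i.e. an order preserving map, such that $\mathcal N$ is generated as a nest by $\phi(\mathcal M)$ (it is the smallest nest on $L$ containing $\phi(\mathcal M)$). The map $\phi$ is called continuous if it is left and right continuous, i.e. $\phi(\bigvee S)=\bigvee\phi(S)$ and $\phi(\bigwedge S)=\bigwedge\phi(S)$ for every $S\subseteq\mathcal M$ (for $S=\emptyset$ this means $\phi(0)=0$ and $\phi(I_H)=I_L$). With $P^\perp=I-P$ put $$\mathrm{Alg}(\mathcal N)=\{a\in B(L): N^\perp aN=0\ \ \forall N\in\mathcal N\},$$ $$Y=\mathrm{Op}(\phi)=\{y\in B(H,L): \phi(M)^\perp yM=0\ \ \forall M\in\mathcal M\},$$ $$X=\{x\in B(L,H): M^\perp x\phi(M)=0\ \ \forall M\in\mathcal M\}.$$ Then the following are equivalent: (i) $\phi$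 is continuous; (ii) $\mathrm{Alg}(\mathcal N)$ is the weak*-closed linear span in $B(L)$ of $YX=\{yx: y\in Y,\ x\in X\}$; (iii) the identity operator $I_L$ belongs to the weak*-closed linear span of $YX$. -/

import Mathlib

/-- A nest on the Hilbert space `H`.  Projections of `H` are represented by their ranges, i.e. by
closed subspaces: `≤` is the order of projections, `sInf` is the intersection and `sSup` is the
closed linear span (so `⊥`, `⊤` are the projections `0`, `I`). -/
structure Nest (H : Type*) [NormedAddCommGroup H] [InnerProductSpace ℂ H] [CompleteSpace H] where
  carrier : Set (ClosedSubmodule ℂ H)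
  isChain : IsChain (· ≤ ·) carrier
  bot_mem : ⊥ ∈ carrier
  top_mem : ⊤ ∈ carrier
  sInf_mem : ∀ S ⊆ carrier, sInf S ∈ carrier
  sSup_mem : ∀ S ⊆ carrier, sSup S ∈ carrier

namespace Nest

variable {H L : Type*} [NormedAddCommGroup H] [InnerProductSpace ℂ H] [CompleteSpace H]
  [NormedAddCommGroup L] [InnerProductSpace ℂ L] [CompleteSpace L]

/-- The members of a nest, ordered as projections. -/
abbrev Elem (𝓜 : Nest H) : Type _ := {M : ClosedSubmodule ℂ H // M ∈ 𝓜.carrier}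

/-- The orthogonal projection of `H` onto a closed subspace. -/
noncomputable def proj (M : ClosedSubmodule ℂ H) : H →L[ℂ] H := M.toSubmodule.starProjection

/-- The complementary projection `M^⊥ = I - M`. -/
noncomputable def coproj (M : ClosedSubmodule ℂ H) : H →L[ℂ] H :=
  ContinuousLinearMap.id ℂ H - proj M

/-- The nest algebra `Alg(𝓜) = {x ∈ B(H) : M^⊥ x M = 0 for all M ∈ 𝓜}`. -/
def alg (𝓜 : Nest H) : Set (H →L[ℂ] H) :=
  {x | ∀ M : 𝓜.Elem, coproj M.1 ∘L x ∘L proj M.1 = 0}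

/-- A nest homomorphism `𝓜 → 𝓝` is an order preserving map. -/
abbrev Hom (𝓜 : Nest H) (𝓝 : Nest L) : Type _ := 𝓜.Elem →o 𝓝.Elem

variable {𝓜 : Nest H} {𝓝 : Nest L}

/-- `Op(φ) = {y ∈ B(H, L) : φ(M)^⊥ y M = 0 for all M ∈ 𝓜}`. -/
def opSpace (φ : Hom 𝓜 𝓝) : Set (H →L[ℂ] L) :=
  {y | ∀ M : 𝓜.Elem, coproj (φ M).1 ∘L y ∘L proj M.1 = 0}

/-- The companion space `{x ∈ B(L, H) : M^⊥ x φ(M) = 0 for all M ∈ 𝓜}`. -/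
def companion (φ : Hom 𝓜 𝓝) : Set (L →L[ℂ] H) :=
  {x | ∀ M : 𝓜.Elem, coproj M.1 ∘L x ∘L proj (φ M).1 = 0}

/-- `𝓝` is generated as a nest by the image of `φ`: it is the smallest nest containing it. -/
def GeneratedByImage (φ : Hom 𝓜 𝓝) : Prop :=
  ∀ 𝓚 : Nest L, (∀ M : 𝓜.Elem, (φ M).1 ∈ 𝓚.carrier) → 𝓝.carrier ⊆ 𝓚.carrier

/-- Left continuity: `φ(⋁ S) = ⋁ φ(S)` for every `S ⊆ 𝓜`, where `⋁` is the closed linear span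
(for `S = ∅` this says `φ(0) = 0`). -/
def LeftContinuous (φ : Hom 𝓜 𝓝) : Prop :=
  ∀ (S : Set 𝓜.Elem) (M : 𝓜.Elem), M.1 = ⨆ K ∈ S, K.1 → (φ M).1 = ⨆ K ∈ S, (φ K).1

/-- Right continuity: `φ(⋀ S) = ⋀ φ(S)` for every `S ⊆ 𝓜`, where `⋀` is the intersection
(for `S = ∅` this says `φ(I) = I`). -/
def RightContinuous (φ : Hom 𝓜 𝓝) : Prop :=
  ∀ (S : Set 𝓜.Elem) (M : 𝓜.Elem), M.1 = ⨅ K ∈ S, K.1 → (φ M).1 = ⨅ K ∈ S, (φ K).1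

/-- A nest homomorphism is continuous if it is left and right continuous. -/
def IsContinuous (φ : Hom 𝓜 𝓝) : Prop := LeftContinuous φ ∧ RightContinuous φ

/-- The set of products `YX = {y x : y ∈ Y, x ∈ X} ⊆ B(L)`. -/
def products (Y : Set (H →L[ℂ] L)) (X : Set (L →L[ℂ] H)) : Set (L →L[ℂ] L) :=
  {a | ∃ y ∈ Y, ∃ x ∈ X, a = y ∘L x}

end Nest

/-- The weak* (ultraweak, σ-weak) topology of `B(L)`: the coarsest topology that makes the
functionals `a ↦ ∑ₙ ⟪ηₙ, a ξₙ⟫` continuous, for all square-summable sequences `ξ`, `η` in `L`.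
These functionals are exactly the elements of the predual of `B(L)`. -/
@[reducible] noncomputable def weakStarTopology (L : Type*) [NormedAddCommGroup L] [InnerProductSpace ℂ L]
    [CompleteSpace L] : TopologicalSpace (L →L[ℂ] L) :=
  ⨅ p : lp (fun _ : ℕ => L) 2 × lp (fun _ : ℕ => L) 2,
    TopologicalSpace.induced (fun a : L →L[ℂ] L => ∑' n : ℕ, inner ℂ (p.2 n) (a (p.1 n)))
      inferInstance

/-- The weak*-closed linear span of a subset of `B(L)`. -/
def weakStarSpan {L : Type*} [NormedAddCommGroup L] [InnerProductSpace ℂ L] [CompleteSpace L]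
    (S : Set (L →L[ℂ] L)) : Set (L →L[ℂ] L) :=
  @closure _ (weakStarTopology L) (Submodule.span ℂ S : Set (L →L[ℂ] L))

/-! Write V for the weak*-closed span of YX. Each product yx maps φ(⋁S) into ⋁φ(S) and ⋀φ(S) into
φ(⋀S), and V inherits this, so I ∈ V forces continuity. V is also a left module over the operators
preserving every φ(M). By generation these are exactly Alg(𝓝), so I ∈ V gives V = Alg(𝓝).

The substance is I ∈ V for continuous φ. Left continuity puts into V every rank one operator v ↦ ⟪η,
v⟫ξ with ξ ∈ φ(M) and η ⊥ φ(M) (`rankOne_mem_weakStarSpan`). From these one builds, for each x and ε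
> 0, a kind of triangular truncation of half the rank one operator of x: some K ∈ V with 2 Re K ≥ x
⊗ x* - ε (`dominatesRankOne_of_isContinuous`). The construction climbs the nest and cannot stop
before the top, by continuity on both sides.

Summing over a finite set of vectors x gives an almost accretive K ∈ V, and F = (t + K)⁻¹K lies in V
by the module property. These F are uniformly bounded and tend strongly to I as t → 0 and the finite
set grows (`id_mem_weakStarSpan_of_accretive`). -/

set_option linter.unusedSectionVars false

/-! ### Projections onto closed subspaces and their limits along chains -/

section Geometry

variable {E F : Type*} [NormedAddCommGroup E] [InnerProductSpace ℂ E] [CompleteSpace E]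
  [NormedAddCommGroup F] [InnerProductSpace ℂ F] [CompleteSpace F]

namespace Nest

theorem proj_mem (M : ClosedSubmodule ℂ E) (v : E) : proj M v ∈ M :=
  M.toSubmodule.starProjection_apply_mem v

theorem proj_eq_self {M : ClosedSubmodule ℂ E} {v : E} (hv : v ∈ M) : proj M v = v :=
  Submodule.starProjection_eq_self_iff.2 hv

theorem inner_proj_left (M : ClosedSubmodule ℂ E) (v w : E) :
    inner ℂ (proj M v) w = inner ℂ v (proj M w) :=
  Submodule.inner_starProjection_left_eq_right _ v w

theorem proj_proj_of_le {M N : ClosedSubmodule ℂ E} (h : M ≤ N) (v : E) :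
    proj N (proj M v) = proj M v :=
  proj_eq_self (h (proj_mem M v))

theorem proj_proj_of_ge {M N : ClosedSubmodule ℂ E} (h : M ≤ N) (v : E) :
    proj M (proj N v) = proj M v := by
  refine ext_inner_left ℂ fun w => ?_
  rw [← inner_proj_left, ← inner_proj_left, proj_proj_of_le h, inner_proj_left]

theorem proj_bot (v : E) : proj (⊥ : ClosedSubmodule ℂ E) v = 0 :=
  proj_mem ⊥ v

theorem proj_top (v : E) : proj (⊤ : ClosedSubmodule ℂ E) v = v :=
  proj_eq_self ClosedSubmodule.mem_top

theorem norm_sub_proj_le (M : ClosedSubmodule ℂ E) (v : E) {w : E} (hw : w ∈ M) :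
    ‖v - proj M v‖ ≤ ‖v - w‖ := by
  rw [proj, Submodule.starProjection_minimal]
  exact ciInf_le ⟨0, by rintro _ ⟨y, rfl⟩; exact norm_nonneg _⟩
    (⟨w, hw⟩ : M.toSubmodule)

theorem inner_sub_proj_right (M : ClosedSubmodule ℂ E) (v : E) {w : E} (hw : w ∈ M) :
    inner ℂ w (v - proj M v) = 0 := by
  rw [inner_sub_right, ← inner_proj_left, proj_eq_self hw, sub_self]

/-- Membership in a closed subspace can be tested against the orthogonal vectors. -/
theorem mem_of_forall_inner_eq_zero {M : ClosedSubmodule ℂ E} {v : E}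
    (h : ∀ w, (∀ u ∈ M, inner ℂ u w = 0) → inner ℂ w v = 0) : v ∈ M := by
  have h1 := h (v - proj M v) fun u hu => inner_sub_proj_right M v hu
  have h2 : inner ℂ (v - proj M v) (v - proj M v) = 0 := by
    rw [inner_sub_right, h1, ← inner_proj_left, zero_sub, neg_eq_zero, map_sub,
      proj_proj_of_le le_rfl, sub_self, inner_zero_left]
  rw [sub_eq_zero.1 (inner_self_eq_zero.1 h2)]
  exact proj_mem M v

/-- `N^⊥ x M = 0` means that `x` maps `M` into `N`. -/
theorem coproj_comp_comp_proj_eq_zero {M : ClosedSubmodule ℂ E} {N : ClosedSubmodule ℂ F}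
    {x : E →L[ℂ] F} : coproj N ∘L x ∘L proj M = 0 ↔ ∀ v ∈ M, x v ∈ N := by
  constructor
  · intro h v hv
    have h1 := DFunLike.congr_fun h v
    simp only [ContinuousLinearMap.comp_apply, proj_eq_self hv, coproj,
      sub_apply, ContinuousLinearMap.id_apply,
      zero_apply, sub_eq_zero] at h1
    rw [h1]
    exact proj_mem _ _
  · intro h
    ext v
    simp [coproj, proj_eq_self (h _ (proj_mem M v))]

/-- The projections onto a chain of subspaces converge strongly to the projection onto the
closed linear span. -/
theorem exists_norm_proj_iSup_sub_lt {ι : Type*} {f : ι → ClosedSubmodule ℂ E} {S : Set ι}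
    (hS : S.Nonempty) (hf : ∀ a ∈ S, ∀ b ∈ S, f a ≤ f b ∨ f b ≤ f a) (x : E) {δ : ℝ}
    (hδ : 0 < δ) : ∃ a ∈ S, ‖proj (⨆ a ∈ S, f a) x - proj (f a) x‖ < δ := by
  have : Nonempty S := hS.to_subtype
  have hle : ∀ a ∈ S, f a ≤ ⨆ a ∈ S, f a := fun a ha => le_iSup₂ (f := fun a (_ : a ∈ S) => f a) a ha
  set N := ⨆ a ∈ S, f a with hN
  have hw : proj N x ∈ ⨆ a : S, f a := by
    have h := proj_mem N x
    have hN' : N = ⨆ a : S, f a := by rw [hN, iSup_subtype']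
    rwa [← hN']
  rw [ClosedSubmodule.mem_iSup] at hw
  obtain ⟨w, hwm, hwd⟩ := Metric.mem_closure_iff.1 hw δ hδ
  have hdir : Directed (· ≤ ·) fun a : S => (f a).toSubmodule := by
    intro a b
    rcases hf a a.2 b b.2 with h | h
    · exact ⟨b, h, le_rfl⟩
    · exact ⟨a, le_rfl, h⟩
  obtain ⟨a, ha⟩ := (Submodule.mem_iSup_of_directed _ hdir).1 hwm
  refine ⟨a, a.2, ?_⟩
  have h1 := norm_sub_proj_le (f a) (proj N x) ha
  rw [proj_proj_of_ge (hle a a.2)] at h1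
  rw [dist_eq_norm] at hwd
  exact h1.trans_lt hwd

theorem proj_orthogonal (M : ClosedSubmodule ℂ E) (v : E) : proj Mᗮ v = v - proj M v := by
  have : proj Mᗮ = ContinuousLinearMap.id ℂ E - proj M :=
    Submodule.starProjection_orthogonal (U := M.toSubmodule)
  rw [this]; rfl

/-- The projections onto a chain of subspaces converge strongly to the projection onto the
intersection. -/
theorem exists_norm_proj_iInf_sub_lt {ι : Type*} {f : ι → ClosedSubmodule ℂ E} {S : Set ι}
    (hS : S.Nonempty) (hf : ∀ a ∈ S, ∀ b ∈ S, f a ≤ f b ∨ f b ≤ f a) (x : E) {δ : ℝ}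
    (hδ : 0 < δ) : ∃ a ∈ S, ‖proj (f a) x - proj (⨅ a ∈ S, f a) x‖ < δ := by
  obtain ⟨a, ha, h⟩ := exists_norm_proj_iSup_sub_lt (f := fun a => (f a)ᗮ) hS
    (fun a ha b hb => (hf b hb a ha).imp ClosedSubmodule.orthogonal_le
      ClosedSubmodule.orthogonal_le) x hδ
  refine ⟨a, ha, ?_⟩
  have : (⨆ a ∈ S, (f a)ᗮ) = (⨅ a ∈ S, f a)ᗮ := by
    apply ClosedSubmodule.orthogonal_injective
    simp only [iSup_subtype', iInf_subtype', ← ClosedSubmodule.iInf_orthogonal,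
      ClosedSubmodule.orthogonal_orthogonal_eq]
  rw [this, proj_orthogonal, proj_orthogonal] at h
  simpa using h

theorem exists_mem_orthogonal_of_lt {M N : ClosedSubmodule ℂ E} (h : M < N) :
    ∃ k ∈ N, k ≠ 0 ∧ ∀ u ∈ M, inner ℂ k u = 0 := by
  obtain ⟨v, hv, hvM⟩ := Set.exists_of_ssubset (show (M : Set E) ⊂ N from h)
  refine ⟨v - proj M v, N.toSubmodule.sub_mem hv (h.le (proj_mem M v)), fun h0 => hvM ?_, fun u hu => ?_⟩
  · rw [sub_eq_zero.1 h0]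
    exact proj_mem M v
  · rw [← inner_conj_symm, inner_sub_proj_right M v hu, map_zero]

end Nest

end Geometry

/-! ### The weak* topology through its defining functionals -/

section WeakStar

variable {L : Type*} [NormedAddCommGroup L] [InnerProductSpace ℂ L] [CompleteSpace L]

theorem summable_norm_mul_norm_lp (ξ η : lp (fun _ : ℕ => L) 2) :
    Summable fun n => ‖ξ n‖ * ‖η n‖ := by
  have h : (2 : ENNReal).toReal.HolderConjugate (2 : ENNReal).toReal := by
    simpa using Real.HolderConjugate.two_two
  exact lp.summable_mul h ξ η

theorem norm_inner_apply_le (a : L →L[ℂ] L) (v w : L) :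
    ‖inner ℂ w (a v)‖ ≤ ‖a‖ * (‖v‖ * ‖w‖) := by
  calc ‖inner ℂ w (a v)‖ ≤ ‖w‖ * ‖a v‖ := norm_inner_le_norm _ _
    _ ≤ ‖w‖ * (‖a‖ * ‖v‖) := by gcongr; exact a.le_opNorm v
    _ = ‖a‖ * (‖v‖ * ‖w‖) := by ring

theorem summable_inner_apply (a : L →L[ℂ] L) (ξ η : lp (fun _ : ℕ => L) 2) :
    Summable fun n => inner ℂ (η n) (a (ξ n)) :=
  .of_norm_bounded ((summable_norm_mul_norm_lp ξ η).mul_left ‖a‖)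
    fun n => norm_inner_apply_le a (ξ n) (η n)

/-- The pairing of an operator with all the functionals `a ↦ ∑ₙ ⟪ηₙ, a ξₙ⟫`. -/
noncomputable def weakStarPairing (L : Type*) [NormedAddCommGroup L] [InnerProductSpace ℂ L]
    [CompleteSpace L] :
    (L →L[ℂ] L) →ₗ[ℂ] (lp (fun _ : ℕ => L) 2 × lp (fun _ : ℕ => L) 2 → ℂ) where
  toFun a p := ∑' n : ℕ, inner ℂ (p.2 n) (a (p.1 n))
  map_add' a b := by
    ext p
    simp only [add_apply, inner_add_right, Pi.add_apply]
    exact (summable_inner_apply a p.1 p.2).tsum_add (summable_inner_apply b p.1 p.2)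
  map_smul' c a := by
    ext p
    simp only [smul_apply, inner_smul_right, Pi.smul_apply, smul_eq_mul,
      RingHom.id_apply]
    exact tsum_mul_left

theorem weakStarTopology_eq_induced :
    weakStarTopology L = TopologicalSpace.induced (weakStarPairing L) inferInstance := by
  simp only [weakStarTopology, Pi.topologicalSpace, induced_iInf, induced_compose]
  rfl

/-- The weak*-closed linear span as a submodule. -/
noncomputable def weakStarSpanSubmodule (S : Set (L →L[ℂ] L)) : Submodule ℂ (L →L[ℂ] L) :=
  (((Submodule.span ℂ S).map (weakStarPairing L)).topologicalClosure).comap (weakStarPairing L)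

theorem coe_weakStarSpanSubmodule (S : Set (L →L[ℂ] L)) :
    (weakStarSpanSubmodule S : Set (L →L[ℂ] L)) = weakStarSpan S := by
  ext a
  rw [weakStarSpan, weakStarTopology_eq_induced, closure_induced]
  rfl

theorem mem_weakStarSpan_iff {S : Set (L →L[ℂ] L)} {a : L →L[ℂ] L} :
    a ∈ weakStarSpan S ↔ weakStarPairing L a ∈
      closure (weakStarPairing L '' (Submodule.span ℂ S : Set (L →L[ℂ] L))) := by
  rw [weakStarSpan, weakStarTopology_eq_induced, closure_induced]

theorem subset_weakStarSpan (S : Set (L →L[ℂ] L)) : S ⊆ weakStarSpan S := fun _ ha =>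
  mem_weakStarSpan_iff.2 <| subset_closure <| Set.mem_image_of_mem _ <| Submodule.subset_span ha

/-- The weak*-closed linear span contains the limits of bounded strongly convergent nets. -/
theorem mem_weakStarSpan_of_tendsto {ι : Type*} {l : Filter ι} [l.NeBot] {S : Set (L →L[ℂ] L)}
    {F : ι → L →L[ℂ] L} {a : L →L[ℂ] L} (hF : ∀ i, F i ∈ weakStarSpan S) (C : ℝ)
    (hC : ∀ i, ‖F i‖ ≤ C) (h : ∀ v, Filter.Tendsto (fun i => F i v) l (nhds (a v))) :
    a ∈ weakStarSpan S := by
  rw [mem_weakStarSpan_iff]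
  refine isClosed_closure.mem_of_tendsto (f := fun i => weakStarPairing L (F i)) (b := l) ?_
    (.of_forall fun i => mem_weakStarSpan_iff.1 (hF i))
  rw [tendsto_pi_nhds]
  intro p
  refine tendsto_tsum_of_dominated_convergence
    ((summable_norm_mul_norm_lp p.1 p.2).mul_left C) (fun n => ?_) (.of_forall fun i n => ?_)
  · exact tendsto_const_nhds.inner (h (p.1 n))
  · refine (norm_inner_apply_le _ _ _).trans ?_
    gcongr
    exact hC i

/-- Left multiplication by b is weak*-continuous: it moves to b* acting on the sequence η, which
stays square-summable. -/
theorem comp_mem_weakStarSpan {S : Set (L →L[ℂ] L)} {b : L →L[ℂ] L}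
    (hb : ∀ a ∈ S, b ∘L a ∈ S) {a : L →L[ℂ] L} (ha : a ∈ weakStarSpan S) :
    b ∘L a ∈ weakStarSpan S := by
  have hq : ∀ η : lp (fun _ : ℕ => L) 2,
      Memℓp (fun n => ContinuousLinearMap.adjoint b (η n)) 2 := by
    intro η
    have h1 := (lp.memℓp η).summable (by simp)
    refine memℓp_gen (.of_nonneg_of_le (fun n => by positivity) (fun n => ?_)
      (h1.mul_left (‖ContinuousLinearMap.adjoint b‖ ^ (2 : ENNReal).toReal)))
    rw [← Real.mul_rpow (norm_nonneg _) (norm_nonneg _)]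
    gcongr
    exact ContinuousLinearMap.le_opNorm _ _
  let q : lp (fun _ : ℕ => L) 2 × lp (fun _ : ℕ => L) 2 →
      lp (fun _ : ℕ => L) 2 × lp (fun _ : ℕ => L) 2 := fun p => (p.1, ⟨_, hq p.2⟩)
  have hpair : ∀ c : L →L[ℂ] L, weakStarPairing L (b ∘L c) = weakStarPairing L c ∘ q := by
    intro c
    ext p
    refine tsum_congr fun n => ?_
    exact (ContinuousLinearMap.adjoint_inner_left b (c (p.1 n)) (p.2 n)).symm
  have hcont : Continuous fun g : lp (fun _ : ℕ => L) 2 × lp (fun _ : ℕ => L) 2 → ℂ => g ∘ q :=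
    continuous_pi fun p => continuous_apply (q p)
  rw [mem_weakStarSpan_iff] at ha ⊢
  rw [hpair]
  refine map_mem_closure (f := fun g => g ∘ q) hcont ha ?_
  rintro _ ⟨c, hc, rfl⟩
  refine ⟨b ∘L c, ?_, hpair c⟩
  have : Submodule.span ℂ S ≤ (Submodule.span ℂ S).comap
      (LinearMap.mulLeft ℂ (b : L →L[ℂ] L)) :=
    Submodule.span_le.2 fun s hs => Submodule.subset_span (hb s hs)
  exact this hc

/-- If all the operators in `S` map `v` into the closed subspace `N`, then so do all those in the
weak*-closed linear span of `S`. -/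
theorem apply_mem_of_mem_weakStarSpan {S : Set (L →L[ℂ] L)} {N : ClosedSubmodule ℂ L} {v : L}
    (h : ∀ a ∈ S, a v ∈ N) {a : L →L[ℂ] L} (ha : a ∈ weakStarSpan S) : a v ∈ N := by
  refine Nest.mem_of_forall_inner_eq_zero fun w hw => ?_
  -- Sequences supported at index 0 make the vector functional c ↦ ⟪w, c v⟫ one of the defining
  -- functionals.
  let p : lp (fun _ : ℕ => L) 2 × lp (fun _ : ℕ => L) 2 := (lp.single 2 0 v, lp.single 2 0 w)
  have hp : ∀ c : L →L[ℂ] L, weakStarPairing L c p = inner ℂ w (c v) := by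
    intro c
    refine (tsum_eq_single 0 fun n hn => ?_).trans ?_
    · simp [p, lp.single_apply, hn]
    · simp [p, lp.single_apply]
  rw [← hp]
  have hcl : IsClosed {g : lp (fun _ : ℕ => L) 2 × lp (fun _ : ℕ => L) 2 → ℂ | g p = 0} :=
    isClosed_eq (continuous_apply p) continuous_const
  refine closure_minimal ?_ hcl (mem_weakStarSpan_iff.1 ha)
  rintro _ ⟨c, hc, rfl⟩
  have hcN : c v ∈ N := by
    have : Submodule.span ℂ S ≤ N.toSubmodule.comap
        (ContinuousLinearMap.apply ℂ L v : (L →L[ℂ] L) →L[ℂ] L).toLinearMap :=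
      Submodule.span_le.2 fun s hs => h s hs
    exact this hc
  change weakStarPairing L c p = 0
  rw [hp, ← inner_conj_symm, hw _ hcN, map_zero]

end WeakStar

/-! ### From accretive operators to an approximate identity -/

section Resolvent

variable {L : Type*} [NormedAddCommGroup L] [InnerProductSpace ℂ L] [CompleteSpace L]

open InnerProductSpace

/-- If `2 Re K ≥ -t` with `t > 0`, then `t + K` is invertible, and its inverse leaves invariant all
the closed subspaces that `K` does. -/
theorem exists_inverse_of_accretive {K : L →L[ℂ] L} {t : ℝ} (ht : 0 < t)
    (hK : ∀ v, -t * ‖v‖ ^ 2 ≤ 2 * (inner ℂ v (K v)).re) :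
    ∃ R : L →L[ℂ] L, R * (t • 1 + K) = 1 ∧ (t • 1 + K) * R = 1 ∧
      ∀ N : ClosedSubmodule ℂ L, (∀ v ∈ N, K v ∈ N) → ∀ v ∈ N, R v ∈ N := by
  -- With mt = ‖K‖², accretivity gives ‖m - K‖² ≤ m² + 2‖K‖² < (m + t)², so t + K = c(1 - T) with
  -- ‖T‖ < 1. The Neumann series matters: inverses need not preserve invariant subspaces, but norm
  -- limits of polynomials in K do.
  set m : ℝ := ‖K‖ ^ 2 / t with hm
  have hmt : m * t = ‖K‖ ^ 2 := by rw [hm]; field_simp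
  have hm0 : 0 ≤ m := by positivity
  set c : ℝ := m + t with hc
  have hc0 : 0 < c := by positivity
  set T : L →L[ℂ] L := c⁻¹ • (m • 1 - K) with hT
  have hnorm : ∀ v, ‖(m • (1 : L →L[ℂ] L) - K) v‖ ^ 2 ≤ (m ^ 2 + 2 * ‖K‖ ^ 2) * ‖v‖ ^ 2 := by
    intro v
    have h1 : ‖(m • (1 : L →L[ℂ] L) - K) v‖ ^ 2
        = m ^ 2 * ‖v‖ ^ 2 - 2 * m * (inner ℂ v (K v)).re + ‖K v‖ ^ 2 := by
      have : (m • (1 : L →L[ℂ] L) - K) v = (m : ℂ) • v - K v := by simp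
      rw [this, @norm_sub_sq ℂ, inner_smul_left, norm_smul]
      simp [mul_pow]
      ring
    have h2 : ‖K v‖ ^ 2 ≤ ‖K‖ ^ 2 * ‖v‖ ^ 2 := by
      rw [← mul_pow]; gcongr; exact K.le_opNorm v
    have h3 := mul_le_mul_of_nonneg_left (hK v) hm0
    rw [h1]
    nlinarith [hmt]
  have hT1 : ‖T‖ < 1 := by
    have h1 : ‖m • (1 : L →L[ℂ] L) - K‖ ≤ √(m ^ 2 + 2 * ‖K‖ ^ 2) := by
      refine ContinuousLinearMap.opNorm_le_bound _ (Real.sqrt_nonneg _) fun v => ?_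
      rw [← Real.sqrt_sq (norm_nonneg ((m • (1 : L →L[ℂ] L) - K) v)),
        ← Real.sqrt_sq (norm_nonneg v), ← Real.sqrt_mul (by positivity)]
      exact Real.sqrt_le_sqrt (hnorm v)
    have h2 : √(m ^ 2 + 2 * ‖K‖ ^ 2) < c := by
      rw [Real.sqrt_lt' hc0, hc]
      nlinarith [hmt, mul_pos ht ht]
    rw [hT, norm_smul, norm_inv, Real.norm_of_nonneg hc0.le, inv_mul_lt_one₀ hc0]
    exact h1.trans_lt h2
  have hTK : t • 1 + K = c • (1 - T) := by
    rw [hT, smul_sub, smul_smul, mul_inv_cancel₀ hc0.ne', one_smul, hc, add_smul]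
    abel
  have hsum : Summable fun n : ℕ => T ^ n := summable_geometric_of_norm_lt_one hT1
  refine ⟨c⁻¹ • ∑' n : ℕ, T ^ n, ?_, ?_, ?_⟩
  · rw [hTK, smul_mul_smul_comm, inv_mul_cancel₀ hc0.ne', one_smul, hsum.tsum_pow_mul_one_sub]
  · rw [hTK, smul_mul_smul_comm, mul_inv_cancel₀ hc0.ne', one_smul, hsum.one_sub_mul_tsum_pow]
  · intro N hN v hv
    have hreal : ∀ (r : ℝ) {w : L}, w ∈ N → r • w ∈ N := fun r w hw => by
      rw [← Complex.coe_smul]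
      exact N.toSubmodule.smul_mem _ hw
    have hTN : ∀ w ∈ N, T w ∈ N := fun w hw =>
      hreal _ (N.toSubmodule.sub_mem (hreal m hw) (hN w hw))
    have hpow : ∀ n, (T ^ n) v ∈ N := by
      intro n
      induction n with
      | zero => simpa using hv
      | succ n ih => rw [pow_succ']; exact hTN _ ih
    refine hreal _ ?_
    have hs : HasSum (fun n => (T ^ n) v) ((∑' n : ℕ, T ^ n) v) :=
      hsum.hasSum.mapL (ContinuousLinearMap.apply ℂ L v)
    exact N.isClosed.mem_of_tendsto hs (.of_forall fun s => N.toSubmodule.sum_mem fun n _ => hpow n)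

/-- A weak*-closed span that is a left module over the operators leaving some closed subspaces
invariant, and consists of such operators, contains the identity as soon as it contains almost
accretive operators whose real part dominates any given rank one projection. -/
theorem id_mem_weakStarSpan_of_accretive {S : Set (L →L[ℂ] L)} {𝒞 : Set (ClosedSubmodule ℂ L)}
    (hS : ∀ a ∈ S, ∀ N ∈ 𝒞, ∀ v ∈ N, a v ∈ N)
    (hmod : ∀ b : L →L[ℂ] L, (∀ N ∈ 𝒞, ∀ v ∈ N, b v ∈ N) → ∀ a ∈ S, b ∘L a ∈ S)
    (hacc : ∀ (x : L) (ε : ℝ), 0 < ε → ∃ K ∈ weakStarSpan S, ∀ v,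
      ‖inner ℂ x v‖ ^ 2 - ε * ‖v‖ ^ 2 ≤ 2 * (inner ℂ v (K v)).re) :
    ContinuousLinearMap.id ℂ L ∈ weakStarSpan S := by
  have hfin : ∀ (s : Finset L) (ε : ℝ), 0 < ε → ∃ K ∈ weakStarSpan S, ∀ v,
      ∑ x ∈ s, ‖inner ℂ x v‖ ^ 2 - ε * ‖v‖ ^ 2 ≤ 2 * (inner ℂ v (K v)).re := by
    classical
    intro s
    induction s using Finset.induction_on with
    | empty =>
      intro ε hε
      refine ⟨0, ?_, fun v => ?_⟩
      · rw [← coe_weakStarSpanSubmodule]; exact zero_mem _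
      · simp; positivity
    | insert x s hx ih =>
      intro ε hε
      obtain ⟨K, hK, hKv⟩ := ih (ε / 2) (by positivity)
      obtain ⟨K', hK', hKv'⟩ := hacc x (ε / 2) (by positivity)
      refine ⟨K' + K, ?_, fun v => ?_⟩
      · rw [← coe_weakStarSpanSubmodule] at hK hK' ⊢
        exact add_mem hK' hK
      · rw [Finset.sum_insert hx, add_apply, inner_add_right, Complex.add_re]
        linarith [hKv v, hKv' v]
  -- The operator is F = RK = 1 - tR with R = (t + K)⁻¹, so the error at x is -tRx.
  have happ : ∀ (s : Finset L) (t : ℝ), 0 < t → ∃ F ∈ weakStarSpan S, ‖F‖ ≤ 3 ∧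
      ∀ x ∈ s, ‖F x - x‖ ^ 2 ≤ 4 * t := by
    intro s t ht
    obtain ⟨K, hK, hKv⟩ := hfin s t ht
    have hKt : ∀ v, -t * ‖v‖ ^ 2 ≤ 2 * (inner ℂ v (K v)).re := fun v => by
      have : 0 ≤ ∑ x ∈ s, ‖inner ℂ x v‖ ^ 2 := by positivity
      linarith [hKv v]
    obtain ⟨R, hRl, hRr, hRinv⟩ := exists_inverse_of_accretive ht hKt
    have hR : ∀ N ∈ 𝒞, ∀ v ∈ N, R v ∈ N := fun N hN => hRinv N fun v hv =>
      apply_mem_of_mem_weakStarSpan (fun a ha => hS a ha N hN v hv) hK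
    have hRK : R ∘L K = 1 - t • R := by
      have : t • R + R * K = 1 := by rw [← hRl, mul_add, mul_smul_comm, mul_one]
      exact eq_sub_of_add_eq' this
    -- Evaluate the lower bound on K at u = tRw, where Ku = t(w - u). Dropping the sum gives ‖u‖ ≤
    -- 2‖w‖, hence ‖F‖ ≤ 3. For w = x ∈ s, the term β² of the sum gives β ≤ 2t, and then ‖u‖² ≤ 2β ≤
    -- 4t.
    have hbound : ∀ w, ∑ x ∈ s, ‖inner ℂ x (t • R w)‖ ^ 2 + t * ‖t • R w‖ ^ 2
        ≤ 2 * t * ‖inner ℂ w (t • R w)‖ := by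
      intro w
      set u := t • R w with hu
      have hKu : K u = (t : ℂ) • w - (t : ℂ) • u := by
        have h1 := DFunLike.congr_fun hRr w
        have h2 : t • R w + K (R w) = w := h1
        rw [hu]
        simp only [← Complex.coe_smul, map_smul]
        simp only [Complex.coe_smul]
        rw [← smul_sub]
        congr 1
        exact eq_sub_of_add_eq' h2
      have h1 := hKv u
      rw [hKu, inner_sub_right, inner_smul_right, inner_smul_right, Complex.sub_re,
        Complex.re_ofReal_mul, Complex.re_ofReal_mul] at h1
      have h2 : (inner ℂ u u).re = ‖u‖ ^ 2 := by
        rw [inner_self_eq_norm_sq_to_K]; norm_cast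
      have h3 : (inner ℂ u w).re ≤ ‖inner ℂ w u‖ := by
        rw [norm_inner_symm]; exact Complex.re_le_norm _
      rw [h2] at h1
      nlinarith [mul_le_mul_of_nonneg_left h3 ht.le]
    refine ⟨R ∘L K, comp_mem_weakStarSpan (hmod R hR) hK, ?_, fun x hx => ?_⟩
    · have h1 : ‖t • R‖ ≤ 2 := by
        refine ContinuousLinearMap.opNorm_le_bound _ (by norm_num) fun w => ?_
        change ‖t • R w‖ ≤ _
        have h2 := hbound w
        have h3 : 0 ≤ ∑ x ∈ s, ‖inner ℂ x (t • R w)‖ ^ 2 := by positivity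
        have h4 := norm_inner_le_norm (𝕜 := ℂ) w (t • R w)
        have h5 : t * (‖t • R w‖ * ‖t • R w‖) ≤ t * (2 * ‖w‖ * ‖t • R w‖) := by
          nlinarith [mul_le_mul_of_nonneg_left h4 ht.le]
        have h6 := le_of_mul_le_mul_left h5 ht
        rcases (norm_nonneg (t • R w)).eq_or_lt with h0 | h0
        · rw [← h0]; positivity
        · exact le_of_mul_le_mul_right h6 h0
      rw [hRK]
      have h2 : ‖(1 : L →L[ℂ] L)‖ ≤ 1 := ContinuousLinearMap.norm_id_le
      linarith [norm_sub_le (1 : L →L[ℂ] L) (t • R)]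
    · have h1 : (R ∘L K) x - x = -(t • R x) := by
        rw [hRK]; simp
      rw [h1, norm_neg]
      have h2 := hbound x
      have h3 := Finset.single_le_sum (f := fun y => ‖inner ℂ y (t • R x)‖ ^ 2)
        (fun _ _ => by positivity) hx
      set β := ‖inner ℂ x (t • R x)‖ with hβ
      have hβ0 : 0 ≤ β := norm_nonneg _
      change β ^ 2 ≤ _ at h3
      have h4 : β ≤ 2 * t := by
        have : 0 ≤ t * ‖t • R x‖ ^ 2 := by positivity
        by_contra! h
        nlinarith
      have h5 : t * ‖t • R x‖ ^ 2 ≤ t * (2 * β) := by nlinarith [sq_nonneg β]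
      linarith [le_of_mul_le_mul_left h5 ht]
  choose! F hFS hF3 hFx using happ
  have hpos : ∀ n : ℕ, (0 : ℝ) < 1 / (n + 1) := fun n => Nat.one_div_pos_of_nat
  classical
  -- L need not be separable, so the net is indexed by finite sets of vectors as well as by t = 1/(n
  -- + 1).
  refine mem_weakStarSpan_of_tendsto (l := (Filter.atTop : Filter (Finset L × ℕ)))
    (F := fun p => F p.1 (1 / (p.2 + 1))) (fun p => hFS _ _ (hpos _)) 3
    (fun p => hF3 _ _ (hpos _)) fun v => ?_
  rw [tendsto_iff_norm_sub_tendsto_zero]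
  have h1 : Filter.Tendsto (fun p : Finset L × ℕ => √(4 * (1 / ((p.2 : ℝ) + 1)))) Filter.atTop
      (nhds 0) := by
    have : Filter.Tendsto (fun p : Finset L × ℕ => p.2) Filter.atTop Filter.atTop := by
      rw [← Filter.prod_atTop_atTop_eq]; exact Filter.tendsto_snd
    have h2 := ((tendsto_one_div_add_atTop_nhds_zero_nat (𝕜 := ℝ)).comp this).const_mul 4
    have h3 := (Real.continuous_sqrt.tendsto _).comp h2
    rwa [mul_zero, Real.sqrt_zero] at h3
  refine squeeze_zero' (.of_forall fun _ => norm_nonneg _) ?_ h1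
  filter_upwards [Filter.eventually_ge_atTop (({v} : Finset L), 0)] with p hp
  refine Real.le_sqrt_of_sq_le (hFx _ _ (hpos _) v ?_)
  exact hp.1 (Finset.mem_singleton_self v)

end Resolvent

/-! ### Nest homomorphisms, invariance and rank one products -/

section NestHom

variable {H L : Type*} [NormedAddCommGroup H] [InnerProductSpace ℂ H] [CompleteSpace H]
  [NormedAddCommGroup L] [InnerProductSpace ℂ L] [CompleteSpace L]

open InnerProductSpace

namespace Nest

theorem mem_alg_iff {𝓝 : Nest L} {a : L →L[ℂ] L} :
    a ∈ 𝓝.alg ↔ ∀ N ∈ 𝓝.carrier, ∀ v ∈ N, a v ∈ N := by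
  simp only [alg, Set.mem_ofPred_eq, coproj_comp_comp_proj_eq_zero, Subtype.forall]

theorem Elem.le_total {𝓜 : Nest H} (M M' : 𝓜.Elem) : M ≤ M' ∨ M' ≤ M :=
  𝓜.isChain.total M.2 M'.2

/-- The closed linear span of a set of members of a nest, as a member of the nest. -/
noncomputable def Elem.span {𝓜 : Nest H} (S : Set 𝓜.Elem) : 𝓜.Elem :=
  ⟨⨆ K ∈ S, K.1, by
    rw [← sSup_image]
    exact 𝓜.sSup_mem _ (by rintro _ ⟨K, -, rfl⟩; exact K.2)⟩

/-- The intersection of a set of members of a nest, as a member of the nest. -/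
noncomputable def Elem.inter {𝓜 : Nest H} (S : Set 𝓜.Elem) : 𝓜.Elem :=
  ⟨⨅ K ∈ S, K.1, by
    rw [← sInf_image]
    exact 𝓜.sInf_mem _ (by rintro _ ⟨K, -, rfl⟩; exact K.2)⟩

theorem Elem.le_span {𝓜 : Nest H} {S : Set 𝓜.Elem} {M : 𝓜.Elem} (h : M ∈ S) : M ≤ span S :=
  le_iSup₂ (f := fun (K : 𝓜.Elem) (_ : K ∈ S) => K.1) M h

theorem Elem.span_le {𝓜 : Nest H} {S : Set 𝓜.Elem} {M : 𝓜.Elem} (h : ∀ K ∈ S, K ≤ M) :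
    span S ≤ M :=
  iSup₂_le (f := fun (K : 𝓜.Elem) (_ : K ∈ S) => K.1) h

theorem Elem.inter_le {𝓜 : Nest H} {S : Set 𝓜.Elem} {M : 𝓜.Elem} (h : M ∈ S) : inter S ≤ M :=
  iInf₂_le (f := fun (K : 𝓜.Elem) (_ : K ∈ S) => K.1) M h

theorem Elem.le_inter {𝓜 : Nest H} {S : Set 𝓜.Elem} {M : 𝓜.Elem} (h : ∀ K ∈ S, M ≤ K) :
    M ≤ inter S :=
  le_iInf₂ (f := fun (K : 𝓜.Elem) (_ : K ∈ S) => K.1) h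

variable {𝓜 : Nest H} {𝓝 : Nest L} {φ : Hom 𝓜 𝓝}

theorem mem_opSpace_iff {y : H →L[ℂ] L} :
    y ∈ opSpace φ ↔ ∀ M : 𝓜.Elem, ∀ v ∈ M.1, y v ∈ (φ M).1 := by
  simp only [opSpace, Set.mem_ofPred_eq, coproj_comp_comp_proj_eq_zero]

theorem mem_companion_iff {x : L →L[ℂ] H} :
    x ∈ companion φ ↔ ∀ M : 𝓜.Elem, ∀ v ∈ (φ M).1, x v ∈ M.1 := by
  simp only [companion, Set.mem_ofPred_eq, coproj_comp_comp_proj_eq_zero]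

theorem apply_mem_of_mem_products {a : L →L[ℂ] L} (ha : a ∈ products (opSpace φ) (companion φ))
    (M : 𝓜.Elem) {v : L} (hv : v ∈ (φ M).1) : a v ∈ (φ M).1 := by
  obtain ⟨y, hy, x, hx, rfl⟩ := ha
  exact mem_opSpace_iff.1 hy M _ (mem_companion_iff.1 hx M v hv)

theorem comp_mem_products {b : L →L[ℂ] L} (hb : ∀ (M : 𝓜.Elem), ∀ v ∈ (φ M).1, b v ∈ (φ M).1)
    {a : L →L[ℂ] L} (ha : a ∈ products (opSpace φ) (companion φ)) :
    b ∘L a ∈ products (opSpace φ) (companion φ) := by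
  obtain ⟨y, hy, x, hx, rfl⟩ := ha
  exact ⟨b ∘L y, mem_opSpace_iff.2 fun M v hv => hb M _ (mem_opSpace_iff.1 hy M v hv), x, hx, rfl⟩

/-- A nest homomorphism is left continuous if the identity is in the span of the products. -/
theorem leftContinuous_of_id_mem
    (h : ContinuousLinearMap.id ℂ L ∈ weakStarSpan (products (opSpace φ) (companion φ))) :
    LeftContinuous φ := by
  intro S M hM
  refine le_antisymm (fun v hv => ?_) (iSup₂_le fun K hK => ?_)
  · refine apply_mem_of_mem_weakStarSpan (v := v) (fun a ha => ?_) h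
    obtain ⟨y, hy, x, hx, rfl⟩ := ha
    -- The preimage under y is a closed subspace, so containing each K it contains their closed
    -- span.
    have h1 : M.1 ≤ (⨆ K ∈ S, (φ K).1).comap y := by
      rw [hM]
      exact iSup₂_le fun K hK w hw =>
        le_iSup₂ (f := fun (K : 𝓜.Elem) (_ : K ∈ S) => (φ K).1) K hK
          (mem_opSpace_iff.1 hy K w hw)
    exact h1 (mem_companion_iff.1 hx M v hv)
  · refine φ.monotone (show K.1 ≤ M.1 from ?_)
    rw [hM]
    exact le_iSup₂ (f := fun (K : 𝓜.Elem) (_ : K ∈ S) => K.1) K hK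

/-- A nest homomorphism is right continuous if the identity is in the span of the products. -/
theorem rightContinuous_of_id_mem
    (h : ContinuousLinearMap.id ℂ L ∈ weakStarSpan (products (opSpace φ) (companion φ))) :
    RightContinuous φ := by
  intro S M hM
  refine le_antisymm (le_iInf₂ fun K hK => ?_) (fun v hv => ?_)
  · refine φ.monotone (show M.1 ≤ K.1 from ?_)
    rw [hM]
    exact iInf₂_le (f := fun (K : 𝓜.Elem) (_ : K ∈ S) => K.1) K hK
  · refine apply_mem_of_mem_weakStarSpan (v := v) (fun a ha => ?_) h
    obtain ⟨y, hy, x, hx, rfl⟩ := ha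
    have h1 : (⨅ K ∈ S, (φ K).1) ≤ M.1.comap x := by
      intro w hw
      rw [hM]
      simp only [ClosedSubmodule.mem_iInf, ClosedSubmodule.mem_comap] at hw ⊢
      exact fun K hK => mem_companion_iff.1 hx K w (hw K hK)
    exact mem_opSpace_iff.1 hy M _ (h1 hv)

/-- An operator leaving invariant the image of a generating nest homomorphism belongs to the nest
algebra. -/
theorem mem_alg_of_generatedByImage (hφ : GeneratedByImage φ) {a : L →L[ℂ] L}
    (ha : ∀ (M : 𝓜.Elem), ∀ v ∈ (φ M).1, a v ∈ (φ M).1) : a ∈ 𝓝.alg := by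
  -- The a-invariant members of 𝓝 form a nest; it contains the image of φ, hence all of 𝓝.
  let 𝓚 : Nest L :=
    { carrier := {N | N ∈ 𝓝.carrier ∧ N ≤ N.comap a}
      isChain := 𝓝.isChain.mono fun _ hN => hN.1
      bot_mem := ⟨𝓝.bot_mem, bot_le⟩
      top_mem := ⟨𝓝.top_mem, fun _ _ => ClosedSubmodule.mem_top⟩
      sInf_mem := fun S hS => ⟨𝓝.sInf_mem S fun N hN => (hS hN).1, fun v hv => by
        rw [ClosedSubmodule.mem_comap]
        rw [ClosedSubmodule.mem_sInf] at hv ⊢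
        exact fun N hN => (hS hN).2 (hv N hN)⟩
      sSup_mem := fun S hS => ⟨𝓝.sSup_mem S fun N hN => (hS hN).1, sSup_le fun N hN v hv =>
        le_sSup (a := N) hN ((hS hN).2 hv)⟩ }
  exact mem_alg_iff.2 fun N hN => (hφ 𝓚 (fun M => ⟨(φ M).2, ha M⟩) hN).2

/-- The weak*-closed span of the products is the nest algebra if it contains the identity. -/
theorem alg_eq_of_id_mem (hφ : GeneratedByImage φ)
    (h : ContinuousLinearMap.id ℂ L ∈ weakStarSpan (products (opSpace φ) (companion φ))) :
    𝓝.alg = weakStarSpan (products (opSpace φ) (companion φ)) := by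
  refine Set.Subset.antisymm (fun a ha => ?_) fun a ha => ?_
  · exact comp_mem_weakStarSpan (b := a)
      (fun c hc => comp_mem_products (fun M => mem_alg_iff.1 ha _ (φ M).2) hc) h
  · exact mem_alg_of_generatedByImage hφ fun M v hv =>
      apply_mem_of_mem_weakStarSpan (fun c hc => apply_mem_of_mem_products hc M hv) ha

/-- A rank one operator is a product of rank one operators as soon as some vector allows it. -/
theorem rankOne_mem_products {ξ η : L} {k : H} (hk : k ≠ 0)
    (hη : ∀ M : 𝓜.Elem, (∀ u ∈ (φ M).1, inner ℂ η u = 0) ∨ k ∈ M.1)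
    (hξ : ∀ M : 𝓜.Elem, (∀ u ∈ M.1, inner ℂ k u = 0) ∨ ξ ∈ (φ M).1) :
    rankOne ℂ ξ η ∈ products (opSpace φ) (companion φ) := by
  refine ⟨(inner ℂ k k : ℂ)⁻¹ • rankOne ℂ ξ k, mem_opSpace_iff.2 fun M v hv => ?_,
    rankOne ℂ k η, mem_companion_iff.2 fun M v hv => ?_, ?_⟩
  · refine (φ M).1.toSubmodule.smul_mem _ ?_
    change inner ℂ k v • ξ ∈ (φ M).1
    rcases hξ M with h | h
    · rw [h v hv, zero_smul]; exact (φ M).1.toSubmodule.zero_mem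
    · exact (φ M).1.toSubmodule.smul_mem _ h
  · rw [rankOne_apply]
    rcases hη M with h | h
    · rw [h v hv, zero_smul]; exact M.1.toSubmodule.zero_mem
    · exact M.1.toSubmodule.smul_mem _ h
  · ext v
    have : (inner ℂ k k : ℂ) ≠ 0 := inner_self_ne_zero.2 hk
    simp only [ContinuousLinearMap.comp_apply, smul_apply, rankOne_apply, map_smul, smul_smul]
    congr 1
    field_simp

/-- Any nonzero k ∈ M₂ ⊖ M₁ serves as intermediate vector: members of 𝓜 below M₁ are orthogonal to
k, and those above M₂ contain it. -/
theorem rankOne_mem_products_of_lt {M₁ M₂ : 𝓜.Elem} (h : M₁ < M₂) {ξ η : L}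
    (hξ : ξ ∈ (φ M₁).1) (hη : ∀ u ∈ (φ M₂).1, inner ℂ η u = 0) :
    rankOne ℂ ξ η ∈ products (opSpace φ) (companion φ) := by
  obtain ⟨k, hk2, hk0, hk1⟩ := exists_mem_orthogonal_of_lt (show M₁.1 < M₂.1 from h)
  refine rankOne_mem_products hk0 (fun M => ?_) fun M => ?_
  · exact (M.le_total M₂).imp (fun hM u hu => hη u (φ.monotone hM hu)) fun hM => hM hk2
  · exact (M.le_total M₁).imp (fun hM u hu => hk1 u (hM hu)) fun hM => φ.monotone hM hξ

/-- When no member lies strictly between M₁ and M₂, the same k allows the weaker conditions ξ ∈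
φ(M₂), η ⊥ φ(M₁), so diagonal blocks are reached too. -/
theorem rankOne_mem_products_of_cover {M₁ M₂ : 𝓜.Elem} (h : M₁ < M₂)
    (hcov : ∀ M, M ≤ M₁ ∨ M₂ ≤ M) {ξ η : L}
    (hξ : ξ ∈ (φ M₂).1) (hη : ∀ u ∈ (φ M₁).1, inner ℂ η u = 0) :
    rankOne ℂ ξ η ∈ products (opSpace φ) (companion φ) := by
  obtain ⟨k, hk2, hk0, hk1⟩ := exists_mem_orthogonal_of_lt (show M₁.1 < M₂.1 from h)
  refine rankOne_mem_products hk0 (fun M => ?_) fun M => ?_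
  · exact (hcov M).imp (fun hM u hu => hη u (φ.monotone hM hu)) fun hM => hM hk2
  · exact (hcov M).imp (fun hM u hu => hk1 u (hM hu)) fun hM => φ.monotone hM hξ

/-- Either M has an immediate predecessor, and the covering case applies, or M is the span of the K
< M. Then left continuity lets ξ be approximated from the φ(K), where K < M supplies the
intermediate vector. -/
theorem rankOne_mem_weakStarSpan (hφ : LeftContinuous φ) {M : 𝓜.Elem} {ξ η : L}
    (hξ : ξ ∈ (φ M).1) (hη : ∀ u ∈ (φ M).1, inner ℂ η u = 0) :
    rankOne ℂ ξ η ∈ weakStarSpan (products (opSpace φ) (companion φ)) := by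
  set S : Set 𝓜.Elem := {K | K < M} with hS
  have hle : Elem.span S ≤ M := Elem.span_le fun K hK => hK.le
  rcases hle.lt_or_eq with hlt | heq
  · refine subset_weakStarSpan _ (rankOne_mem_products_of_cover hlt (fun K => ?_) hξ
      fun u hu => hη u (φ.monotone hle hu))
    rcases M.le_total K with h | h
    · exact .inr h
    · rcases h.lt_or_eq with h | h
      · exact .inl (Elem.le_span h)
      · exact .inr h.ge
  · have hφM : (φ M).1 = ⨆ K ∈ S, (φ K).1 := hφ S M (congrArg Subtype.val heq.symm)
    rcases S.eq_empty_or_nonempty with h0 | hne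
    · have : ξ ∈ (⊥ : ClosedSubmodule ℂ L) := by
        rw [hφM, h0] at hξ; simpa using hξ
      rw [ClosedSubmodule.mem_bot] at this
      rw [this, map_zero, zero_apply, ← coe_weakStarSpanSubmodule]
      exact zero_mem _
    · have hex : ∀ n : ℕ, ∃ K ∈ S, ‖ξ - proj (φ K).1 ξ‖ < 1 / (n + 1) := fun n => by
        obtain ⟨K, hK, h⟩ := exists_norm_proj_iSup_sub_lt (f := fun K => (φ K).1) hne
          (fun a _ b _ => (φ a).le_total (φ b)) ξ (Nat.one_div_pos_of_nat (α := ℝ) (n := n))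
        refine ⟨K, hK, ?_⟩
        rwa [← hφM, proj_eq_self hξ] at h
      choose K hKS hK using hex
      have hlim : Filter.Tendsto (fun n => proj (φ (K n)).1 ξ) Filter.atTop (nhds ξ) := by
        rw [tendsto_iff_norm_sub_tendsto_zero]
        refine squeeze_zero (fun _ => norm_nonneg _) (fun n => ?_)
          (tendsto_one_div_add_atTop_nhds_zero_nat (𝕜 := ℝ))
        rw [norm_sub_rev]
        exact (hK n).le
      refine mem_weakStarSpan_of_tendsto (l := Filter.atTop)
        (F := fun n => rankOne ℂ (proj (φ (K n)).1 ξ) η) (fun n => subset_weakStarSpan _ ?_)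
        (‖ξ‖ * ‖η‖) (fun n => ?_) fun v => ?_
      · exact rankOne_mem_products_of_lt (hKS n) (proj_mem _ _) hη
      · rw [norm_rankOne]
        gcongr
        exact Submodule.norm_starProjection_apply_le _ _
      · exact hlim.const_smul _

end Nest

end NestHom

/-! ### Building accretive operators along the nest -/

section Density

variable {H L : Type*} [NormedAddCommGroup H] [InnerProductSpace ℂ H] [CompleteSpace H]
  [NormedAddCommGroup L] [InnerProductSpace ℂ L] [CompleteSpace L]

open InnerProductSpace

namespace Nest

/-- `V` contains an operator whose real part is at least
`(Px ⊗ (Px)* - ε P) / 2`. -/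
def DominatesRankOne (V : Submodule ℂ (L →L[ℂ] L)) (x : L) (ε : ℝ) (P : L →L[ℂ] L) : Prop :=
  ∃ K ∈ V, ∀ v, ‖inner ℂ (P x) v‖ ^ 2 - ε * ‖P v‖ ^ 2 ≤ 2 * (inner ℂ v (K v)).re

theorem norm_sq_add_eq (a b : ℂ) :
    ‖a + b‖ ^ 2 = ‖a‖ ^ 2 + 2 * (b * starRingEnd ℂ a).re + ‖b‖ ^ 2 := by
  rw [Complex.sq_norm, Complex.sq_norm, Complex.sq_norm, Complex.normSq_add, ← Complex.conj_re]
  simp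
  ring

theorem inner_rankOne_apply_self (ξ d v : L) :
    inner ℂ v (rankOne ℂ ξ d v) = inner ℂ d v * starRingEnd ℂ (inner ℂ ξ v) := by
  rw [rankOne_apply, inner_smul_right, inner_conj_symm]

/-- Enlarging the projection, when the new part of `x` is small. -/
theorem DominatesRankOne.step_of_norm_le {V : Submodule ℂ (L →L[ℂ] L)} {x : L} {ε : ℝ}
    {M N : ClosedSubmodule ℂ L} (hMN : M ≤ N)
    (hV : ∀ ξ ∈ M, ∀ η, (∀ u ∈ M, inner ℂ η u = 0) → rankOne ℂ ξ η ∈ V)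
    (hx : ‖proj N x - proj M x‖ ^ 2 ≤ ε) (h : DominatesRankOne V x ε (proj M)) :
    DominatesRankOne V x ε (proj N) := by
  obtain ⟨K, hKV, hK⟩ := h
  set d := proj N x - proj M x with hd
  have hdM : ∀ u ∈ M, inner ℂ d u = 0 := fun u hu => by
    rw [hd, ← proj_proj_of_ge hMN x, ← inner_conj_symm, inner_sub_proj_right M _ hu, map_zero]
  -- The added operator yields exactly the cross term in |⟪Px + d, v⟫|², with P the projection onto
  -- M. The leftover |⟪d, v⟫|² is absorbed by the growth of ε‖Pv‖² from M to N; the errors sit on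
  -- orthogonal pieces, so they never accumulate.
  refine ⟨K + rankOne ℂ (proj M x) d, V.add_mem hKV (hV _ (proj_mem M x) _ hdM), fun v => ?_⟩
  have h1 : inner ℂ (proj N x) v = inner ℂ (proj M x) v + inner ℂ d v := by
    rw [← inner_add_left, hd, add_sub_cancel]
  have h2 : inner ℂ d v = inner ℂ d (proj N v - proj M v) := by
    rw [inner_sub_right, hdM _ (proj_mem M v), sub_zero, ← inner_proj_left]
    congr 1
    rw [hd, map_sub, proj_proj_of_le le_rfl, proj_proj_of_le hMN]
  have h3 : ‖proj N v‖ ^ 2 = ‖proj M v‖ ^ 2 + ‖proj N v - proj M v‖ ^ 2 := by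
    have horth : inner ℂ (proj M v) (proj N v - proj M v) = 0 := by
      rw [← proj_proj_of_ge hMN v]
      exact inner_sub_proj_right M _ (proj_mem M _)
    have := norm_add_sq_eq_norm_sq_add_norm_sq_of_inner_eq_zero _ _ horth
    rw [add_sub_cancel] at this
    simpa [sq] using this
  have h4 : ‖inner ℂ d v‖ ^ 2 ≤ ε * ‖proj N v - proj M v‖ ^ 2 := by
    rw [h2]
    calc ‖inner ℂ d (proj N v - proj M v)‖ ^ 2
        ≤ (‖d‖ * ‖proj N v - proj M v‖) ^ 2 := by gcongr; exact norm_inner_le_norm _ _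
      _ = ‖d‖ ^ 2 * ‖proj N v - proj M v‖ ^ 2 := mul_pow _ _ _
      _ ≤ _ := by gcongr
  rw [h1, norm_sq_add_eq, h3, add_apply, inner_add_right, Complex.add_re, inner_rankOne_apply_self]
  nlinarith [hK v]

/-- Enlarging the projection, when `V` contains all the operators on the new part. -/
theorem DominatesRankOne.step_of_cover {V : Submodule ℂ (L →L[ℂ] L)} {x : L} {ε : ℝ} (hε : 0 ≤ ε)
    {M N : ClosedSubmodule ℂ L} (hMN : M ≤ N)
    (hV : ∀ ξ ∈ N, ∀ η, (∀ u ∈ M, inner ℂ η u = 0) → rankOne ℂ ξ η ∈ V)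
    (h : DominatesRankOne V x ε (proj M)) : DominatesRankOne V x ε (proj N) := by
  obtain ⟨K, hKV, hK⟩ := h
  set d := proj N x - proj M x with hd
  have hdM : ∀ u ∈ M, inner ℂ d u = 0 := fun u hu => by
    rw [hd, ← proj_proj_of_ge hMN x, ← inner_conj_symm, inner_sub_proj_right M _ hu, map_zero]
  have hdN : d ∈ N := N.toSubmodule.sub_mem (proj_mem N x) (hMN (proj_mem M x))
  -- Here d may be large, but its own rank one operator lies in V; half of it supplies |⟪d, v⟫|²
  -- exactly.
  refine ⟨K + rankOne ℂ (proj M x) d + (2⁻¹ : ℂ) • rankOne ℂ d d,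
    V.add_mem (V.add_mem hKV (hV _ (hMN (proj_mem M x)) _ hdM)) (V.smul_mem _ (hV _ hdN _ hdM)),
    fun v => ?_⟩
  have h1 : inner ℂ (proj N x) v = inner ℂ (proj M x) v + inner ℂ d v := by
    rw [← inner_add_left, hd, add_sub_cancel]
  have h3 : ‖proj M v‖ ^ 2 ≤ ‖proj N v‖ ^ 2 := by
    rw [← proj_proj_of_ge hMN v]
    gcongr
    exact Submodule.norm_starProjection_apply_le _ _
  have h4 : 2 * ((2⁻¹ : ℂ) * (inner ℂ d v * starRingEnd ℂ (inner ℂ d v))).re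
      = ‖inner ℂ d v‖ ^ 2 := by
    rw [Complex.mul_conj, Complex.sq_norm]
    simp
  have h5 := mul_le_mul_of_nonneg_left h3 hε
  rw [h1, norm_sq_add_eq, add_apply, add_apply, smul_apply, inner_add_right, inner_add_right,
    inner_smul_right, Complex.add_re, Complex.add_re, inner_rankOne_apply_self,
    inner_rankOne_apply_self]
  linarith [hK v]

variable {𝓜 : Nest H} {𝓝 : Nest L} {φ : Hom 𝓜 𝓝}

/-- Left continuity shows that the supremum of the good members is good. Below the top it could be
enlarged: by the covering step if it has an immediate successor, otherwise by right continuity,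
which gives a larger member with a small jump of x. -/
theorem dominatesRankOne_of_isContinuous (hφ : IsContinuous φ) (x : L) {ε : ℝ} (hε : 0 < ε) :
    DominatesRankOne (weakStarSpanSubmodule (products (opSpace φ) (companion φ))) x ε
      (ContinuousLinearMap.id ℂ L) := by
  set V := weakStarSpanSubmodule (products (opSpace φ) (companion φ)) with hV
  have hmemV : ∀ {a}, a ∈ V ↔ a ∈ weakStarSpan (products (opSpace φ) (companion φ)) := fun {a} => by
    rw [← coe_weakStarSpanSubmodule]; rfl
  have hsmall : ∀ {M M' : 𝓜.Elem}, M ≤ M' →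
      ‖proj (φ M').1 x - proj (φ M).1 x‖ < √ε →
      DominatesRankOne V x ε (proj (φ M).1) → DominatesRankOne V x ε (proj (φ M').1) :=
    fun {M M'} hM hx h => h.step_of_norm_le (φ.monotone hM)
      (fun ξ hξ η hη => hmemV.2 (rankOne_mem_weakStarSpan hφ.1 hξ hη))
      ((Real.lt_sqrt (norm_nonneg _)).1 hx).le
  set G : Set 𝓜.Elem := {M | DominatesRankOne V x ε (proj (φ M).1)} with hG
  have hGsup : Elem.span G ∈ G := by
    have hφG := hφ.1 G (Elem.span G) rfl
    -- For empty G, left continuity at ∅ gives φ(0) = 0, so K = 0 works there.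
    rcases G.eq_empty_or_nonempty with h0 | hne
    · have hbot : (φ (Elem.span G)).1 = ⊥ := by rw [hφG, h0]; simp
      refine ⟨0, V.zero_mem, fun v => ?_⟩
      rw [hbot, proj_bot, proj_bot]
      simp
    · obtain ⟨M, hM, h⟩ := exists_norm_proj_iSup_sub_lt (f := fun K => (φ K).1) hne
        (fun a _ b _ => (φ a).le_total (φ b)) x (Real.sqrt_pos.2 hε)
      rw [← hφG] at h
      exact hsmall (Elem.le_span hM) h hM
  set M := Elem.span G with hM
  set S : Set 𝓜.Elem := {K | M < K} with hS
  have hMS : M ≤ Elem.inter S := Elem.le_inter fun K hK => le_of_lt hK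
  have hmax : ∀ K ∈ G, ¬ M < K := fun K hK h => h.not_ge (Elem.le_span hK)
  have hSempty : S = ∅ := by
    by_contra! hne
    rcases hMS.lt_or_eq with hlt | heq
    · refine hmax (Elem.inter S) ?_ hlt
      refine DominatesRankOne.step_of_cover hε.le (φ.monotone hMS) (fun ξ hξ η hη =>
        hmemV.2 (subset_weakStarSpan _
          (rankOne_mem_products_of_cover hlt (fun K => ?_) hξ hη))) hGsup
      rcases K.le_total M with h | h
      · exact .inl h
      · rcases h.lt_or_eq with h | h
        · exact .inr (Elem.inter_le h)
        · exact .inl h.ge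
    · have hφM : (φ M).1 = ⨅ K ∈ S, (φ K).1 := hφ.2 S M (congrArg Subtype.val heq)
      obtain ⟨K, hK, h⟩ := exists_norm_proj_iInf_sub_lt (f := fun K => (φ K).1) hne
        (fun a _ b _ => (φ a).le_total (φ b)) x (Real.sqrt_pos.2 hε)
      rw [← hφM] at h
      exact hmax K (hsmall (le_of_lt hK) h hGsup) hK
  have hMtop : M.1 = ⊤ := by
    by_contra hne
    have : (⟨⊤, 𝓜.top_mem⟩ : 𝓜.Elem) ∈ S := lt_top_iff_ne_top.2 hne
    rw [hSempty] at this
    exact this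
  have hφtop : (φ M).1 = ⊤ := by
    rw [hφ.2 ∅ M (by rw [hMtop]; simp)]; simp
  have hproj : proj (φ M).1 = ContinuousLinearMap.id ℂ L := by
    ext v
    rw [hφtop, proj_top, ContinuousLinearMap.id_apply]
  rw [← hproj]
  exact hGsup

theorem id_mem_of_isContinuous (hφ : IsContinuous φ) :
    ContinuousLinearMap.id ℂ L ∈ weakStarSpan (products (opSpace φ) (companion φ)) := by
  refine id_mem_weakStarSpan_of_accretive (𝒞 := Set.range fun M : 𝓜.Elem => (φ M).1) ?_ ?_ ?_
  · rintro a ha _ ⟨M, rfl⟩ v hv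
    exact apply_mem_of_mem_products ha M hv
  · exact fun b hb a ha => comp_mem_products (fun M => hb _ ⟨M, rfl⟩) ha
  · intro x ε hε
    obtain ⟨K, hKV, hK⟩ := dominatesRankOne_of_isContinuous hφ x hε
    exact ⟨K, by rw [← coe_weakStarSpanSubmodule]; exact hKV, hK⟩

end Nest

end Density

theorem theorem2p2
    {H L : Type*} [NormedAddCommGroup H] [InnerProductSpace ℂ H] [CompleteSpace H]
    [NormedAddCommGroup L] [InnerProductSpace ℂ L] [CompleteSpace L]
    (𝓜 : Nest H) (𝓝 : Nest L) (φ : Nest.Hom 𝓜 𝓝) (hφ : Nest.GeneratedByImage φ) :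
    List.TFAE
      [Nest.IsContinuous φ,
       𝓝.alg = weakStarSpan (Nest.products (Nest.opSpace φ) (Nest.companion φ)),
       ContinuousLinearMap.id ℂ L ∈
         weakStarSpan (Nest.products (Nest.opSpace φ) (Nest.companion φ))] := by
  tfae_have 1 → 3 := Nest.id_mem_of_isContinuous
  tfae_have 3 → 1 := fun h => ⟨Nest.leftContinuous_of_id_mem h, Nest.rightContinuous_of_id_mem h⟩
  tfae_have 3 → 2 := Nest.alg_eq_of_id_mem hφ
  tfae_have 2 → 3 := fun h => by
    rw [← h]
    exact Nest.mem_alg_iff.2 fun _ _ _ hv => hv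
  tfae_finish
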